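/- Let $n\ge 1$, let $\Sigma^n$ be a smooth $n$-manifold without boundary and let $X:\Sigma\to\mathbb R^{n+1}$ be a proper smooth immersion such that $X(\Sigma)$ is not contained in any sphere $S^n(R)=\{x\in\mathbb R^{n+1}:\|x\|=R\}$, $R>0$. Equip $\Sigma$ with the metric induced by $X$, let $\Delta^\Sigma$ be its Laplace–Beltrami operator, $r=\|X\|$ the extrinsic distance to the origin and $D_R=\{p\in\Sigma: r(p)<R\}$ the extrinsic ball of radius $R$. Let $\alpha\in\mathbb R$, $\alpha\ne 0,1$, and suppose that for every $R>0$ the mean exit time function $E_R$ of $D_R$, i.e. the function $E_R\in C^2(D_R)\cap C^0(\overline{D_R})$ solving $$\Delta^\Sigma E_R+1=0\ \text{ on } D_R,\qquad E_R=0\ \text{ on }\partial D_R,$$ exists and satisfies $E_R=\alpha\,\bar E_R$ on $D_R$, where $\bar E_R(p)=\dfrac{R^2-r(p)^2}{2n}$. Then $X$ is a soliton for the inverse mean curvature flow (IMCF) with respect to the origin, with velocity $$C=\frac{\alpha}{(\alpha-1)\,n};$$ that is, the induced metric is complete, the mean curvature vector $\vec H$ (the trace of the second fundamental form) vanishes nowhere,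 and $\dfrac{\vec H}{\|\vec H\|^2}=-C\,X^\perp$ on $\Sigma$, where $X^\perp$ is the normal component of $X$. Hence $X$ is a self-expander ($C>0$) if $\alpha>1$, and a self-shrinker ($C<0$) if $0<\alpha<1$. -/

import Mathlib

open Set Filter Topology Metric
open scoped Manifold ContDiff ENNReal

noncomputable section

namespace IMCF

/-- The `i`-th partial derivative `∂ᵢu` of a map on `ℝⁿ` (with values in a normed space). -/
def pderiv {n : ℕ} {F : Type*} [NormedAddCommGroup F] [NormedSpace ℝ F] (i : Fin n)
    (u : EuclideanSpace ℝ (Fin n) → F) (y : EuclideanSpace ℝ (Fin n)) : F :=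
  fderiv ℝ u y (EuclideanSpace.single i 1)

/-- Christoffel symbols `Γᵏᵢⱼ = ½ ∑ₗ gᵏˡ (∂ᵢ gⱼₗ + ∂ⱼ gᵢₗ - ∂ₗ gᵢⱼ)` of the Levi-Civita connection
of a metric `g` given in coordinates. -/
def christoffel {n : ℕ} (g : EuclideanSpace ℝ (Fin n) → Matrix (Fin n) (Fin n) ℝ)
    (i j k : Fin n) (y : EuclideanSpace ℝ (Fin n)) : ℝ :=
  (1 / 2) * ∑ l, (g y)⁻¹ k l *
    (pderiv i (fun z => g z j l) y + pderiv j (fun z => g z i l) y - pderiv l (fun z => g z i j) y)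

/-- The Hessian `∂ᵢ∂ⱼu - ∑ₖ Γᵏᵢⱼ ∂ₖu` of a function with respect to a metric `g` given in
coordinates. -/
def hessianCoord {n : ℕ} (g : EuclideanSpace ℝ (Fin n) → Matrix (Fin n) (Fin n) ℝ)
    (u : EuclideanSpace ℝ (Fin n) → ℝ) (i j : Fin n) (y : EuclideanSpace ℝ (Fin n)) : ℝ :=
  pderiv i (pderiv j u) y - ∑ k, christoffel g i j k y * pderiv k u y

/-- The Laplace-Beltrami operator, i.e. the trace of the Hessian with respect to the metric `g`,
in coordinates. -/
def laplacianCoord {n : ℕ} (g : EuclideanSpace ℝ (Fin n) → Matrix (Fin n) (Fin n) ℝ)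
    (u : EuclideanSpace ℝ (Fin n) → ℝ) (y : EuclideanSpace ℝ (Fin n)) : ℝ :=
  ∑ i, ∑ j, (g y)⁻¹ i j * hessianCoord g u i j y

section Submanifold

variable {n d : ℕ} {M : Type*} [TopologicalSpace M] [ChartedSpace (EuclideanSpace ℝ (Fin n)) M]

/-- A smooth immersion into Euclidean space: a smooth map with injective differentials. -/
structure IsSmoothImmersion (X : M → EuclideanSpace ℝ (Fin d)) : Prop where
  smooth : ContMDiff (𝓡 n) (𝓡 d) ∞ X
  injective_mfderiv : ∀ p : M, Function.Injective (mfderiv (𝓡 n) (𝓡 d) X p)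

/-- The expression of a map on `M` in the preferred chart around `p`. -/
def inChart {F : Type*} (p : M) (f : M → F) : EuclideanSpace ℝ (Fin n) → F :=
  fun y => f ((extChartAt (𝓡 n) p).symm y)

/-- The metric induced by `X`, in the preferred chart around `p`:
`gᵢⱼ = ⟨∂ᵢX, ∂ⱼX⟩`. -/
def inducedMetric (X : M → EuclideanSpace ℝ (Fin d)) (p : M) (y : EuclideanSpace ℝ (Fin n)) :
    Matrix (Fin n) (Fin n) ℝ :=
  Matrix.of fun i j => inner ℝ (pderiv i (inChart p X) y) (pderiv j (inChart p X) y)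

/-- The Laplace-Beltrami operator of the metric induced on `M` by `X`. -/
def laplacian (X : M → EuclideanSpace ℝ (Fin d)) (f : M → ℝ) (p : M) : ℝ :=
  laplacianCoord (inducedMetric X p) (inChart p f) (extChartAt (𝓡 n) p p)

/-- The image of the tangent space of `M` at `p` under the differential of `X`. -/
def tangentImage (X : M → EuclideanSpace ℝ (Fin d)) (p : M) :
    Submodule ℝ (EuclideanSpace ℝ (Fin d)) :=
  LinearMap.range
    (show EuclideanSpace ℝ (Fin n) →L[ℝ] EuclideanSpace ℝ (Fin d) from
      mfderiv (𝓡 n) (𝓡 d) X p).toLinearMap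

/-- The normal component `v^⊥` at `p` of a vector of the ambient space. -/
def normalPart (X : M → EuclideanSpace ℝ (Fin d)) (p : M) (v : EuclideanSpace ℝ (Fin d)) :
    EuclideanSpace ℝ (Fin d) :=
  (tangentImage (n := n) X p)ᗮ.starProjection v

/-- The second fundamental form `(∂ᵢ∂ⱼX)^⊥` at `p`, evaluated on the coordinate vector fields of the
preferred chart around `p`. -/
def secondFundamentalForm (X : M → EuclideanSpace ℝ (Fin d)) (p : M) (i j : Fin n) :
    EuclideanSpace ℝ (Fin d) :=
  normalPart (n := n) X p (pderiv i (pderiv j (inChart p X)) (extChartAt (𝓡 n) p p))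

/-- The mean curvature vector: the (unnormalized) trace of the second fundamental form with respect
to the induced metric. -/
def meanCurvature (X : M → EuclideanSpace ℝ (Fin d)) (p : M) : EuclideanSpace ℝ (Fin d) :=
  ∑ i, ∑ j, (inducedMetric (n := n) X p (extChartAt (𝓡 n) p p))⁻¹ i j •
    secondFundamentalForm X p i j

/-- The Riemannian distance of the metric induced by `X`: the infimum of the lengths of `C¹` paths,
where a tangent vector `v` has length `‖dX v‖`. -/
def inducedEDist (X : M → EuclideanSpace ℝ (Fin d)) (p q : M) : ℝ≥0∞ :=
  letI : ∀ x : M, ENorm (TangentSpace (𝓡 n) x) := fun x =>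
    ⟨fun v => ‖(show EuclideanSpace ℝ (Fin d) from mfderiv (𝓡 n) (𝓡 d) X x v)‖ₑ⟩
  Manifold.riemannianEDist (𝓡 n) p q

/-- The metric induced by `X` is complete: Cauchy sequences for the Riemannian distance converge. -/
def IsCompleteInduced (X : M → EuclideanSpace ℝ (Fin d)) : Prop :=
  ∀ u : ℕ → M,
    (∀ ε : ℝ≥0∞, 0 < ε → ∃ N, ∀ i ≥ N, ∀ j ≥ N, inducedEDist (n := n) X (u i) (u j) < ε) →
      ∃ p : M, Tendsto u atTop (𝓝 p)

/-- `X` is a soliton for the inverse mean curvature flow with respect to the origin, with velocity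
`C`: a complete immersion with `H / ‖H‖² = - C X^⊥` (so that `H` vanishes nowhere). -/
structure IsSoliton (X : M → EuclideanSpace ℝ (Fin d)) (C : ℝ) : Prop where
  immersion : IsSmoothImmersion (n := n) X
  complete : IsCompleteInduced (n := n) X
  meanCurvature_ne_zero : ∀ p : M, meanCurvature (n := n) X p ≠ 0
  eqn : ∀ p : M, (‖meanCurvature (n := n) X p‖ ^ 2)⁻¹ • meanCurvature (n := n) X p =
    -(C • normalPart (n := n) X p (X p))

/-- A self-shrinker for the inverse mean curvature flow: a soliton with velocity `C < 0`. -/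
def IsSelfShrinker (X : M → EuclideanSpace ℝ (Fin d)) : Prop :=
  ∃ C : ℝ, C < 0 ∧ IsSoliton (n := n) X C

/-- A self-expander for the inverse mean curvature flow: a soliton with velocity `C > 0`. -/
def IsSelfExpander (X : M → EuclideanSpace ℝ (Fin d)) : Prop :=
  ∃ C : ℝ, 0 < C ∧ IsSoliton (n := n) X C

/-- `E` is the mean exit time function on an open set `D ⊆ M`, i.e. the classical solution of the
Poisson problem `ΔE + 1 = 0` on `D`, `E = 0` on `∂D`, for the metric induced by `X`. -/
structure IsMeanExitTime (X : M → EuclideanSpace ℝ (Fin d)) (D : Set M) (E : M → ℝ) : Prop where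
  contMDiffOn : ContMDiffOn (𝓡 n) 𝓘(ℝ, ℝ) 2 E D
  continuousOn : ContinuousOn E (closure D)
  poisson : ∀ p ∈ D, laplacian (n := n) X E p + 1 = 0
  boundary : ∀ p ∈ frontier D, E p = 0

end Submanifold

/-- The extrinsic ball `D_R = X⁻¹(B_R(0))`. -/
def extrinsicBall {d : ℕ} {M : Type*} (X : M → EuclideanSpace ℝ (Fin d)) (R : ℝ) : Set M :=
  X ⁻¹' ball 0 R

/-- The function `Ē_R = (R² - r²) / (2n)`, where `r = ‖X‖` is the extrinsic distance to the
origin. -/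
def transplantedExitTime (n : ℕ) {d : ℕ} {M : Type*} (X : M → EuclideanSpace ℝ (Fin d)) (R : ℝ)
    (p : M) : ℝ :=
  (R ^ 2 - ‖X p‖ ^ 2) / (2 * n)

end IMCF

end

/-! The argument rests on the identity `Δ‖X‖² = 2(n + ⟨H, X⟩)`. Since `E_R` is affine in `‖X‖²` on
`D_R`, the Poisson equation becomes `α(n + ⟨H, X⟩) = n`, so `⟨H, X⟩ = -(α - 1)n/α = -1/C` is a
constant, nonzero because `α ≠ 1`. Hence `H` never vanishes. In codimension one it spans the normal
line, so `X^⊥ = (⟨H, X⟩/‖H‖²) H`, which rearranges to the soliton equation. The identity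
(`laplacianCoord_const_add_mul_norm_sq`, `laplacian_eq`) follows from the Gauss formula in
coordinates. Completeness comes from properness: `X` does not increase distance, so the image of a
Cauchy sequence converges, and properness yields a cluster point. Convergence in the manifold
topology then follows by trapping short paths near that point, which is isolated in its fibre. -/

namespace IMCF

/-! ### Gauss formula and Laplacian of the squared norm, in coordinates -/

section Coordinates

variable {n d : ℕ} {Y : EuclideanSpace ℝ (Fin n) → EuclideanSpace ℝ (Fin d)}
  {y : EuclideanSpace ℝ (Fin n)}

lemma differentiableAt_pderiv (hY : ContDiffAt ℝ 2 Y y) (j : Fin n) :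
    DifferentiableAt ℝ (pderiv j Y) y := by
  have h : ContDiffAt ℝ 1 (fderiv ℝ Y) y := hY.fderiv_right (by norm_num)
  exact (h.differentiableAt (by norm_num)).clm_apply (differentiableAt_const _)

lemma pderiv_pderiv (hY : ContDiffAt ℝ 2 Y y) (i j : Fin n) :
    pderiv i (pderiv j Y) y =
      fderiv ℝ (fderiv ℝ Y) y (EuclideanSpace.single i 1) (EuclideanSpace.single j 1) := by
  have h : DifferentiableAt ℝ (fderiv ℝ Y) y :=
    ContDiffAt.differentiableAt (n := 1) (hY.fderiv_right (by norm_num)) (by norm_num)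
  have e : pderiv j Y = fun z => fderiv ℝ Y z (EuclideanSpace.single j 1) := rfl
  rw [e, pderiv, fderiv_clm_apply h (differentiableAt_const _)]
  simp

lemma pderiv_comm (hY : ContDiffAt ℝ 2 Y y) (i j : Fin n) :
    pderiv i (pderiv j Y) y = pderiv j (pderiv i Y) y := by
  rw [pderiv_pderiv hY, pderiv_pderiv hY]
  exact hY.isSymmSndFDerivAt (by simp) _ _

lemma pderiv_inner {f g : EuclideanSpace ℝ (Fin n) → EuclideanSpace ℝ (Fin d)}
    (hf : DifferentiableAt ℝ f y) (hg : DifferentiableAt ℝ g y) (i : Fin n) :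
    pderiv i (fun z => inner ℝ (f z) (g z)) y =
      inner ℝ (f y) (pderiv i g y) + inner ℝ (pderiv i f y) (g y) :=
  fderiv_inner_apply ℝ hf hg _

/-- The metric induced by a map in coordinates. -/
noncomputable def pullbackMetric {n d : ℕ} (Y : EuclideanSpace ℝ (Fin n) → EuclideanSpace ℝ (Fin d))
    (z : EuclideanSpace ℝ (Fin n)) : Matrix (Fin n) (Fin n) ℝ :=
  Matrix.of fun i j => inner ℝ (pderiv i Y z) (pderiv j Y z)

lemma pullbackMetric_comm (i j : Fin n) : pullbackMetric Y y i j = pullbackMetric Y y j i :=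
  real_inner_comm (pderiv j Y y) (pderiv i Y y)

lemma linearIndependent_pderiv (hinj : Function.Injective (fderiv ℝ Y y)) :
    LinearIndependent ℝ fun i => pderiv i Y y := by
  have h := (EuclideanSpace.basisFun (Fin n) ℝ).toBasis.linearIndependent.map'
    (fderiv ℝ Y y).toLinearMap (LinearMap.ker_eq_bot.2 hinj)
  have e : (fun i => pderiv i Y y) =
      (fderiv ℝ Y y).toLinearMap ∘ (EuclideanSpace.basisFun (Fin n) ℝ).toBasis := by
    ext i
    simp [pderiv]
  rw [e]
  exact h

lemma isUnit_det_pullbackMetric (hinj : Function.Injective (fderiv ℝ Y y)) :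
    IsUnit (pullbackMetric Y y).det :=
  (Matrix.det_gram_ne_zero_iff_linearIndependent.2 (linearIndependent_pderiv hinj)).isUnit

lemma pderiv_pullbackMetric (hY : ContDiffAt ℝ 2 Y y) (i j l : Fin n) :
    pderiv i (fun z => pullbackMetric Y z j l) y =
      inner ℝ (pderiv j Y y) (pderiv i (pderiv l Y) y) +
        inner ℝ (pderiv i (pderiv j Y) y) (pderiv l Y y) :=
  pderiv_inner (differentiableAt_pderiv hY j) (differentiableAt_pderiv hY l) i

/-- The three metric derivatives expand into six terms; by symmetry of second derivatives four
cancel and the other two coincide, absorbing the factor `1/2`. -/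
lemma christoffel_pullbackMetric (hY : ContDiffAt ℝ 2 Y y) (i j k : Fin n) :
    christoffel (pullbackMetric Y) i j k y =
      ∑ l, (pullbackMetric Y y)⁻¹ k l * inner ℝ (pderiv i (pderiv j Y) y) (pderiv l Y y) := by
  rw [christoffel, Finset.mul_sum]
  refine Finset.sum_congr rfl fun l _ => ?_
  rw [pderiv_pullbackMetric hY, pderiv_pullbackMetric hY, pderiv_pullbackMetric hY,
    pderiv_comm hY i l, pderiv_comm hY j l, pderiv_comm hY j i,
    real_inner_comm (pderiv l (pderiv i Y) y), real_inner_comm (pderiv l (pderiv j Y) y)]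
  ring

/-- Lowering the index with `g` cancels `g⁻¹`. These are the equations saying that `∂ᵢ∂ⱼY - ∑ₖ Γᵏᵢⱼ
∂ₖY` is orthogonal to every `∂ₗY`. -/
lemma sum_christoffel_mul_pullbackMetric (hY : ContDiffAt ℝ 2 Y y)
    (hinj : Function.Injective (fderiv ℝ Y y)) (i j l : Fin n) :
    ∑ k, christoffel (pullbackMetric Y) i j k y * pullbackMetric Y y k l =
      inner ℝ (pderiv i (pderiv j Y) y) (pderiv l Y y) := by
  have hdet := isUnit_det_pullbackMetric hinj
  have hone (m : Fin n) :
      ∑ k, (pullbackMetric Y y) l k * (pullbackMetric Y y)⁻¹ k m = (1 : Matrix _ _ ℝ) l m := by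
    rw [← Matrix.mul_apply, Matrix.mul_nonsing_inv _ hdet]
  calc _ = ∑ k, ∑ m, (pullbackMetric Y y l k * (pullbackMetric Y y)⁻¹ k m) *
        inner ℝ (pderiv i (pderiv j Y) y) (pderiv m Y y) := by
        refine Finset.sum_congr rfl fun k _ => ?_
        rw [christoffel_pullbackMetric hY, Finset.sum_mul]
        refine Finset.sum_congr rfl fun m _ => ?_
        rw [pullbackMetric_comm l k]
        ring
    _ = _ := by
        rw [Finset.sum_comm]
        simp_rw [← Finset.sum_mul, hone, Matrix.one_apply]
        simp

lemma range_fderiv_eq_span :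
    LinearMap.range (fderiv ℝ Y y).toLinearMap = Submodule.span ℝ (range fun i => pderiv i Y y) := by
  have h := (EuclideanSpace.basisFun (Fin n) ℝ).toBasis.span_eq
  rw [LinearMap.range_eq_map, ← h, Submodule.map_span, ← range_comp]
  congr 2
  ext i
  simp [pderiv]

/-- The Gauss formula in coordinates: the normal part of `∂ᵢ∂ⱼY` is `∂ᵢ∂ⱼY - ∑ₖ Γᵏᵢⱼ ∂ₖY`. -/
lemma orthogonal_starProjection_pderiv_pderiv (hY : ContDiffAt ℝ 2 Y y)
    (hinj : Function.Injective (fderiv ℝ Y y)) (i j : Fin n) :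
    (LinearMap.range (fderiv ℝ Y y).toLinearMap)ᗮ.starProjection (pderiv i (pderiv j Y) y) =
      pderiv i (pderiv j Y) y - ∑ k, christoffel (pullbackMetric Y) i j k y • pderiv k Y y := by
  have hmem (k : Fin n) : pderiv k Y y ∈ LinearMap.range (fderiv ℝ Y y).toLinearMap := ⟨_, rfl⟩
  rw [Submodule.starProjection_orthogonal, sub_apply,
    ContinuousLinearMap.id_apply,
    Submodule.eq_starProjection_of_mem_orthogonal
      (v := ∑ k, christoffel (pullbackMetric Y) i j k y • pderiv k Y y)]
  · exact Submodule.sum_mem _ fun k _ => Submodule.smul_mem _ _ (hmem k)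
  · rw [range_fderiv_eq_span, Submodule.mem_orthogonal]
    intro u hu
    induction hu using Submodule.span_induction with
    | zero => simp
    | add u v _ _ hu hv => rw [inner_add_left, hu, hv, add_zero]
    | smul c u _ hu => rw [inner_smul_left, hu, mul_zero]
    | mem u hu =>
      obtain ⟨l, rfl⟩ := hu
      rw [real_inner_comm, inner_sub_left, sum_inner,
        ← sum_christoffel_mul_pullbackMetric hY hinj, sub_eq_zero]
      refine Finset.sum_congr rfl fun k _ => ?_
      rw [real_inner_smul_left]
      rfl

lemma pderiv_const_add_mul_norm_sq (a b : ℝ) {z : EuclideanSpace ℝ (Fin n)}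
    (hY : DifferentiableAt ℝ Y z) (j : Fin n) :
    pderiv j (fun w => a + b * ‖Y w‖ ^ 2) z = 2 * b * inner ℝ (pderiv j Y z) (Y z) := by
  have h : HasFDerivAt (fun w => a + b * ‖Y w‖ ^ 2)
      (b • (2 • (innerSL ℝ (Y z)).comp (fderiv ℝ Y z))) z :=
    (hY.hasFDerivAt.norm_sq.const_mul b).const_add a
  rw [pderiv, h.fderiv]
  simp [pderiv, real_inner_comm]
  ring

/-- Differentiating twice gives `2b(⟨∂ᵢ∂ⱼY, Y⟩ + gᵢⱼ)`; by the Gauss formula the Christoffel terms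
remove exactly the tangential part of `∂ᵢ∂ⱼY`. -/
lemma hessianCoord_const_add_mul_norm_sq (hY : ContDiffAt ℝ 2 Y y)
    (hinj : Function.Injective (fderiv ℝ Y y)) (a b : ℝ) (i j : Fin n) :
    hessianCoord (pullbackMetric Y) (fun w => a + b * ‖Y w‖ ^ 2) i j y =
      2 * b * (inner ℝ ((LinearMap.range (fderiv ℝ Y y).toLinearMap)ᗮ.starProjection
        (pderiv i (pderiv j Y) y)) (Y y) + pullbackMetric Y y i j) := by
  have hev : pderiv j (fun w => a + b * ‖Y w‖ ^ 2) =ᶠ[𝓝 y]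
      fun z => inner ℝ (((2 * b) • pderiv j Y) z) (Y z) := by
    filter_upwards [hY.eventually (by simp)] with z hz
    rw [pderiv_const_add_mul_norm_sq a b (hz.differentiableAt (by norm_num)), Pi.smul_apply,
      real_inner_smul_left]
  have hd : DifferentiableAt ℝ Y y := hY.differentiableAt (by norm_num)
  have hdj := differentiableAt_pderiv hY j
  have h1 : pderiv i (pderiv j (fun w => a + b * ‖Y w‖ ^ 2)) y =
      2 * b * (inner ℝ (pderiv i (pderiv j Y) y) (Y y) + pullbackMetric Y y i j) := by
    have hs : pderiv i ((2 * b) • pderiv j Y) y = (2 * b) • pderiv i (pderiv j Y) y := by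
      rw [pderiv, fderiv_const_smul hdj]; rfl
    rw [pderiv, hev.fderiv_eq]
    refine (pderiv_inner (hdj.const_smul _) hd i).trans ?_
    rw [hs, Pi.smul_apply, real_inner_smul_left, real_inner_smul_left, pullbackMetric_comm,
      pullbackMetric, Matrix.of_apply]
    ring
  rw [hessianCoord, h1, orthogonal_starProjection_pderiv_pderiv hY hinj, inner_sub_left, sum_inner]
  simp_rw [pderiv_const_add_mul_norm_sq a b hd, real_inner_smul_left]
  have : ∑ k, christoffel (pullbackMetric Y) i j k y * (2 * b * inner ℝ (pderiv k Y y) (Y y)) =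
      2 * b * ∑ k, christoffel (pullbackMetric Y) i j k y * inner ℝ (pderiv k Y y) (Y y) := by
    rw [Finset.mul_sum]
    exact Finset.sum_congr rfl fun k _ => by ring
  rw [this]
  ring

/-- The coordinate form of `Δ‖Y‖² = 2 (n + ⟨H, Y⟩)`. -/
lemma laplacianCoord_const_add_mul_norm_sq (hY : ContDiffAt ℝ 2 Y y)
    (hinj : Function.Injective (fderiv ℝ Y y)) (a b : ℝ) :
    laplacianCoord (pullbackMetric Y) (fun w => a + b * ‖Y w‖ ^ 2) y =
      2 * b * (inner ℝ (∑ i, ∑ j, (pullbackMetric Y y)⁻¹ i j •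
        (LinearMap.range (fderiv ℝ Y y).toLinearMap)ᗮ.starProjection
          (pderiv i (pderiv j Y) y)) (Y y) + n) := by
  have htr : ∑ i, ∑ j, (pullbackMetric Y y)⁻¹ i j * pullbackMetric Y y i j = n := by
    have h : ∀ i, ∑ j, (pullbackMetric Y y)⁻¹ i j * pullbackMetric Y y i j = 1 := fun i => by
      simp_rw [pullbackMetric_comm (Y := Y) (y := y) i]
      rw [← Matrix.mul_apply, Matrix.nonsing_inv_mul _ (isUnit_det_pullbackMetric hinj),
        Matrix.one_apply_eq]
    simp [h]
  simp_rw [laplacianCoord, hessianCoord_const_add_mul_norm_sq hY hinj, sum_inner,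
    real_inner_smul_left]
  rw [← htr, ← Finset.sum_add_distrib, Finset.mul_sum]
  refine Finset.sum_congr rfl fun i _ => ?_
  rw [← Finset.sum_add_distrib, Finset.mul_sum]
  exact Finset.sum_congr rfl fun j _ => by ring

/-- Locality is needed because `E_R` has its explicit form only on `D_R`. -/
lemma laplacianCoord_congr {g : EuclideanSpace ℝ (Fin n) → Matrix (Fin n) (Fin n) ℝ}
    {u v : EuclideanSpace ℝ (Fin n) → ℝ} (h : u =ᶠ[𝓝 y] v) :
    laplacianCoord g u y = laplacianCoord g v y := by
  have h1 (j : Fin n) : pderiv j u =ᶠ[𝓝 y] pderiv j v := by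
    filter_upwards [h.fderiv (𝕜 := ℝ)] with z hz
    rw [pderiv, hz, pderiv]
  have h2 (i j : Fin n) : pderiv i (pderiv j u) y = pderiv i (pderiv j v) y := by
    rw [pderiv, (h1 j).fderiv_eq, pderiv]
  simp only [laplacianCoord, hessianCoord, h2, fun j => (h1 j).eq_of_nhds]

end Coordinates

end IMCF

namespace IMCF

/-! ### Transfer to the manifold; codimension one -/

section Manifolds

variable {n d : ℕ} {M : Type*} [TopologicalSpace M] [ChartedSpace (EuclideanSpace ℝ (Fin n)) M]
  {X : M → EuclideanSpace ℝ (Fin d)}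

lemma mfderiv_eq_fderiv_inChart {p : M} (hX : MDifferentiableAt (𝓡 n) (𝓡 d) X p) :
    (mfderiv (𝓡 n) (𝓡 d) X p : EuclideanSpace ℝ (Fin n) →L[ℝ] EuclideanSpace ℝ (Fin d)) =
      fderiv ℝ (inChart (n := n) p X) (extChartAt (𝓡 n) p p) := by
  rw [hX.mfderiv]
  have e : writtenInExtChartAt (𝓡 n) (𝓡 d) p X = inChart (n := n) p X := by
    ext1 y
    simp only [writtenInExtChartAt, extChartAt_model_space_eq_id]
    rfl
  rw [e, modelWithCornersSelf_coe, range_id, fderivWithin_univ]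

lemma contDiffAt_inChart [IsManifold (𝓡 n) ∞ M] (hX : ContMDiff (𝓡 n) (𝓡 d) ∞ X) (p : M) :
    ContDiffAt ℝ 2 (inChart (n := n) p X) (extChartAt (𝓡 n) p p) := by
  have h1 : ContMDiffAt (𝓡 n) (𝓡 n) ∞ (extChartAt (𝓡 n) p).symm (extChartAt (𝓡 n) p p) :=
    (contMDiffOn_extChartAt_symm p).contMDiffAt (extChartAt_target_mem_nhds p)
  have h2 : ContMDiffAt (𝓡 n) (𝓡 d) ∞ (inChart (n := n) p X) (extChartAt (𝓡 n) p p) :=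
    hX.contMDiffAt.comp _ h1
  exact h2.contDiffAt.of_le (WithTop.coe_le_coe.2 le_top)

lemma inChart_extChartAt {F : Type*} (p : M) (f : M → F) :
    inChart (n := n) p f (extChartAt (𝓡 n) p p) = f p := by
  simp [inChart]

lemma laplacian_eq [IsManifold (𝓡 n) ∞ M] (hX : IsSmoothImmersion (n := n) X) {f : M → ℝ} {p : M}
    {a b : ℝ} (hf : ∀ᶠ q in 𝓝 p, f q = a + b * ‖X q‖ ^ 2) :
    laplacian (n := n) X f p = 2 * b * (inner ℝ (meanCurvature (n := n) X p) (X p) + n) := by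
  have hmd := hX.smooth.mdifferentiableAt (by simp) (x := p)
  have hfd := mfderiv_eq_fderiv_inChart hmd
  have hinj : Function.Injective (fderiv ℝ (inChart (n := n) p X) (extChartAt (𝓡 n) p p)) := by
    rw [← hfd]; exact hX.injective_mfderiv p
  have htend : Tendsto (extChartAt (𝓡 n) p).symm (𝓝 (extChartAt (𝓡 n) p p)) (𝓝 p) := by
    simpa using (continuousAt_extChartAt_symm (I := 𝓡 n) p).tendsto
  have hev : inChart (n := n) p f =ᶠ[𝓝 (extChartAt (𝓡 n) p p)]
      fun w => a + b * ‖inChart (n := n) p X w‖ ^ 2 := htend.eventually hf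
  have h := laplacianCoord_const_add_mul_norm_sq (contDiffAt_inChart hX.smooth p) hinj a b
  rw [inChart_extChartAt, ← hfd] at h
  exact (laplacianCoord_congr hev).trans h

lemma finrank_tangentImage (hX : IsSmoothImmersion (n := n) X) (p : M) :
    Module.finrank ℝ (tangentImage (n := n) X p) = n := by
  rw [tangentImage]
  refine (LinearMap.finrank_range_of_inj (f := (show EuclideanSpace ℝ (Fin n) →L[ℝ]
    EuclideanSpace ℝ (Fin d) from mfderiv (𝓡 n) (𝓡 d) X p).toLinearMap)
    (hX.injective_mfderiv p)).trans ?_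
  exact finrank_euclideanSpace_fin

lemma normalPart_mem (p : M) (v : EuclideanSpace ℝ (Fin d)) :
    normalPart (n := n) X p v ∈ (tangentImage (n := n) X p)ᗮ :=
  Submodule.starProjection_apply_mem _ _

lemma meanCurvature_mem (p : M) :
    meanCurvature (n := n) X p ∈ (tangentImage (n := n) X p)ᗮ :=
  Submodule.sum_mem _ fun _ _ => Submodule.sum_mem _ fun _ _ =>
    Submodule.smul_mem _ _ (normalPart_mem _ _)

/-- In codimension one, `H / ‖H‖² = ⟨H, X⟩⁻¹ X^⊥` wherever `⟨H, X⟩ ≠ 0`. -/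
lemma inv_norm_sq_smul_meanCurvature {X : M → EuclideanSpace ℝ (Fin (n + 1))}
    (hX : IsSmoothImmersion (n := n) X) {p : M}
    (h : inner ℝ (meanCurvature (n := n) X p) (X p) ≠ 0) :
    (‖meanCurvature (n := n) X p‖ ^ 2)⁻¹ • meanCurvature (n := n) X p =
      (inner ℝ (meanCurvature (n := n) X p) (X p))⁻¹ • normalPart (n := n) X p (X p) := by
  set H := meanCurvature (n := n) X p with hH
  have hH0 : H ≠ 0 := fun h0 => h (by rw [h0, inner_zero_left])
  have hHmem : H ∈ (tangentImage (n := n) X p)ᗮ := meanCurvature_mem p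
  -- The normal space is a line, so the nonzero `H` spans it and `X^⊥ = c • H`; pairing with `H`
  -- gives `⟨H, X⟩ = c‖H‖²`.
  have hrank : Module.finrank ℝ (tangentImage (n := n) X p)ᗮ = 1 := by
    have := Submodule.finrank_add_finrank_orthogonal (tangentImage (n := n) X p)
    rw [finrank_tangentImage hX, finrank_euclideanSpace_fin] at this
    omega
  have hinner : inner ℝ H (X p) = inner ℝ H (normalPart (n := n) X p (X p)) := by
    rw [normalPart, ← Submodule.inner_starProjection_left_eq_right,
      Submodule.starProjection_eq_self_iff.2 hHmem]
  obtain ⟨c, hc⟩ := (finrank_eq_one_iff_of_nonzero' (⟨H, hHmem⟩ : (tangentImage (n := n) X p)ᗮ)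
    (by simpa using hH0)).1 hrank ⟨_, normalPart_mem p (X p)⟩
  have hc' : c • H = normalPart (n := n) X p (X p) := congrArg Subtype.val hc
  have hn : ‖H‖ ^ 2 ≠ 0 := by simpa using hH0
  rw [← hc', real_inner_smul_right, real_inner_self_eq_norm_sq] at hinner
  rw [hinner] at h
  rw [hinner, ← hc']
  have hc0 : c ≠ 0 := left_ne_zero_of_mul h
  rw [smul_smul]
  congr 1
  field_simp

end Manifolds

/-! ### Completeness of the induced metric -/

section Completeness

variable {n d : ℕ} {M : Type*} [TopologicalSpace M] [ChartedSpace (EuclideanSpace ℝ (Fin n)) M]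
  {X : M → EuclideanSpace ℝ (Fin d)}

/-- Points at induced distance less than `r` are joined by a path whose image under `X` stays in
the ball of radius `r`. -/
lemma exists_path_of_inducedEDist_lt (hX : ContMDiff (𝓡 n) (𝓡 d) ∞ X) {p q : M} {r : ℝ≥0∞}
    (h : inducedEDist (n := n) X p q < r) :
    ∃ γ : ℝ → M, γ 0 = p ∧ γ 1 = q ∧ ContinuousOn γ (Icc 0 1) ∧
      ∀ t ∈ Icc (0 : ℝ) 1, edist (X (γ t)) (X p) < r := by
  let : ∀ x : M, ENorm (TangentSpace (𝓡 n) x) := fun x =>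
    ⟨fun v => ‖(show EuclideanSpace ℝ (Fin d) from mfderiv (𝓡 n) (𝓡 d) X x v)‖ₑ⟩
  obtain ⟨γ, h0, h1, hγ, hlen⟩ := Manifold.exists_lt_of_riemannianEDist_lt h
  refine ⟨γ, h0, h1, hγ.continuousOn, fun t ht => lt_of_le_of_lt ?_ hlen⟩
  have hsub : Icc 0 t ⊆ Icc (0 : ℝ) 1 := Icc_subset_Icc_right ht.2
  have hc : ContDiffOn ℝ 1 (X ∘ γ) (Icc 0 t) := by
    rw [← contMDiffOn_iff_contDiffOn]
    exact (hX.of_le (by exact_mod_cast le_top)).comp_contMDiffOn (hγ.mono hsub)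
  have hle := enorm_sub_le_lintegral_deriv_of_contDiffOn_Icc hc ht.1
  have heq : ∫⁻ s in Icc 0 t, ‖deriv (X ∘ γ) s‖ₑ = Manifold.pathELength (𝓡 n) γ 0 t := by
    -- On the open interval `γ` is differentiable in the two-sided sense, so the chain rule
    -- identifies the integrands.
    rw [Manifold.pathELength_eq_lintegral_mfderiv_Ioo, ← MeasureTheory.restrict_Ioo_eq_restrict_Icc]
    refine MeasureTheory.setLIntegral_congr_fun measurableSet_Ioo fun s hs => ?_
    have hγs : MDifferentiableAt 𝓘(ℝ, ℝ) (𝓡 n) γ s :=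
      (hγ.contMDiffAt (Icc_mem_nhds hs.1 (hs.2.trans_le ht.2))).mdifferentiableAt one_ne_zero
    have hXs : MDifferentiableAt (𝓡 n) (𝓡 d) X (γ s) := hX.mdifferentiableAt (by simp)
    have hcomp := mfderiv_comp s hXs hγs
    rw [mfderiv_eq_fderiv] at hcomp
    have hd : deriv (X ∘ γ) s = fderiv ℝ (X ∘ γ) s 1 := rfl
    change ‖deriv (X ∘ γ) s‖ₑ =
      ‖(show EuclideanSpace ℝ (Fin d) from
        mfderiv (𝓡 n) (𝓡 d) X (γ s) (mfderiv 𝓘(ℝ, ℝ) (𝓡 n) γ s 1))‖ₑ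
    rw [hd, hcomp]
    rfl
  rw [edist_eq_enorm_sub, ← h0]
  exact hle.trans (heq.trans_le (Manifold.pathELength_mono le_rfl ht.2))

/-- An immersion is locally injective at each point. -/
lemma eventually_ne_of_isSmoothImmersion [IsManifold (𝓡 n) ∞ M]
    (hX : IsSmoothImmersion (n := n) X) (p : M) : ∀ᶠ q in 𝓝 p, X q = X p → q = p := by
  have hmd := hX.smooth.mdifferentiableAt (by simp) (x := p)
  have hfd := mfderiv_eq_fderiv_inChart hmd
  have hinj : Function.Injective (fderiv ℝ (inChart (n := n) p X) (extChartAt (𝓡 n) p p)) := by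
    rw [← hfd]; exact hX.injective_mfderiv p
  obtain ⟨K, -, hK⟩ := LinearMap.exists_antilipschitzWith
    (fderiv ℝ (inChart (n := n) p X) (extChartAt (𝓡 n) p p)).toLinearMap (LinearMap.ker_eq_bot.2 hinj)
  have hdiff := (contDiffAt_inChart hX.smooth p).differentiableAt (by norm_num)
  have hne := hdiff.hasFDerivAt.eventually_ne (c := X p) ⟨K, hK⟩
  rw [eventually_nhdsWithin_iff] at hne
  filter_upwards [(continuousAt_extChartAt (I := 𝓡 n) p).eventually hne,
    extChartAt_source_mem_nhds (I := 𝓡 n) p] with q hq hsource hXq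
  by_contra hqp
  refine hq (fun h => hqp ?_) ?_
  · exact (extChartAt (𝓡 n) p).injOn hsource (mem_extChartAt_source p) h
  · rwa [inChart, (extChartAt (𝓡 n) p).left_inv hsource]

/-- The metric induced by a proper immersion is complete. -/
lemma isCompleteInduced_of_isProperMap [T2Space M] [IsManifold (𝓡 n) ∞ M]
    (hX : IsSmoothImmersion (n := n) X) (hproper : IsProperMap X) :
    IsCompleteInduced (n := n) X := by
  intro u hu
  have hedist {p q : M} {r : ℝ≥0∞} (h : inducedEDist (n := n) X p q < r) :
      edist (X q) (X p) < r := by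
    obtain ⟨γ, -, h1, -, hγ⟩ := exists_path_of_inducedEDist_lt hX.smooth h
    rw [← h1]
    exact hγ 1 (right_mem_Icc.2 zero_le_one)
  have hcauchy : CauchySeq fun i => X (u i) := by
    rw [EMetric.cauchySeq_iff]
    intro ε hε
    obtain ⟨N, hN⟩ := hu ε hε
    exact ⟨N, fun i hi j hj => hedist (hN j hj i hi)⟩
  obtain ⟨y, hy⟩ := cauchySeq_tendsto_of_complete hcauchy
  obtain ⟨p, hXp, hp⟩ : ∃ p, X p = y ∧ MapClusterPt p atTop u :=
    hproper.clusterPt_of_mapClusterPt hy.mapClusterPt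
  refine ⟨p, tendsto_nhds.2 fun W hW hpW => ?_⟩
  have hcpt : IsCompact (X ⁻¹' {y}) := hproper.isCompact_preimage isCompact_singleton
  obtain ⟨V, hV, hVo, hpV⟩ := eventually_nhds_iff.1 (eventually_ne_of_isSmoothImmersion hX p)
  -- As `p` is isolated in the compact fibre, it can be separated from the rest of the fibre by
  -- disjoint open sets.
  obtain ⟨A, B, hA, hB, hpA, hFB, hAB⟩ : SeparatedNhds {p} (X ⁻¹' {y} \ V) :=
    SeparatedNhds.of_isCompact_isCompact isCompact_singleton (hcpt.diff hVo)
      (disjoint_singleton_left.2 fun h => h.2 hpV)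
  set A' := A ∩ W
  have hA' : IsOpen A' := hA.inter hW
  have hpA' : p ∈ A' := ⟨hpA rfl, hpW⟩
  have hA'B : Disjoint A' B := hAB.mono_left inter_subset_left
  have hfib : X ⁻¹' {y} ⊆ A' ∪ B := by
    intro q hq
    by_cases hqV : q ∈ V
    · left
      rwa [hV q hqV (by rw [hXp]; exact hq)]
    · exact Or.inr (hFB ⟨hq, hqV⟩)
  -- Tube argument: `X` is closed, so a neighbourhood of the fibre contains the preimage of a small
  -- ball about `y`.
  obtain ⟨ε, hε, hball⟩ : ∃ ε > 0, Metric.eball y ε ⊆ (X '' (A' ∪ B)ᶜ)ᶜ := by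
    refine EMetric.mem_nhds_iff.1 (IsOpen.mem_nhds ?_ ?_)
    · exact (hproper.isClosedMap _ (hA'.union hB).isClosed_compl).isOpen_compl
    · rintro ⟨q, hq, hqy⟩
      exact hq (hfib hqy)
  have hmem {q : M} (hq : edist (X q) y < ε) : q ∈ A' ∪ B := by
    by_contra hq'
    exact hball hq ⟨q, hq', rfl⟩
  -- One half bounds the excursion of the path from `X (u i)`, the other the distance from `X (u i)`
  -- to `y`.
  have hε2 : 0 < ε / 2 := ENNReal.half_pos hε.ne'
  obtain ⟨N, hN⟩ := hu (ε / 2) hε2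
  obtain ⟨i, hiA, hiN, hiy⟩ : ∃ i, u i ∈ A' ∧ N ≤ i ∧ edist (X (u i)) y < ε / 2 :=
    ((hp.frequently (hA'.mem_nhds hpA')).and_eventually
      ((eventually_ge_atTop N).and (hy.eventually (Metric.eball_mem_nhds y hε2)))).exists
  filter_upwards [eventually_ge_atTop N] with j hj
  obtain ⟨γ, h0, h1, hγc, hγ⟩ := exists_path_of_inducedEDist_lt hX.smooth (hN i hiN j hj)
  -- The path is connected, lies in the disjoint union `A' ∪ B` and starts in `A'`, so it cannot
  -- reach `B`.
  have hsub : γ '' Icc 0 1 ⊆ A' := by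
    refine IsPreconnected.subset_left_of_subset_union hA' hB hA'B ?_ ?_
      (isPreconnected_Icc.image _ hγc)
    · rintro _ ⟨t, ht, rfl⟩
      refine hmem ((edist_triangle _ (X (u i)) _).trans_lt ?_)
      calc _ < ε / 2 + ε / 2 := ENNReal.add_lt_add (hγ t ht) hiy
        _ = ε := ENNReal.add_halves ε
    · exact ⟨γ 0, mem_image_of_mem _ (left_mem_Icc.2 zero_le_one), h0 ▸ hiA⟩
  exact (hsub ⟨1, right_mem_Icc.2 zero_le_one, h1⟩).2

end Completeness

end IMCF

/-! ### The soliton equation -/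

theorem theorem8p3 {n : ℕ} (hn : 1 ≤ n)
    {M : Type*} [TopologicalSpace M] [T2Space M] [SecondCountableTopology M]
    [ChartedSpace (EuclideanSpace ℝ (Fin n)) M] [IsManifold (𝓡 n) ∞ M]
    (X : M → EuclideanSpace ℝ (Fin (n + 1)))
    (hX : IMCF.IsSmoothImmersion (n := n) X) (hproper : IsProperMap X)
    (hns : ¬ ∃ R : ℝ, 0 < R ∧ range X ⊆ sphere 0 R)
    (α : ℝ) (hα0 : α ≠ 0) (hα1 : α ≠ 1)
    (E : ℝ → M → ℝ)
    (hE : ∀ R : ℝ, 0 < R → IMCF.IsMeanExitTime (n := n) X (IMCF.extrinsicBall X R) (E R))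
    (hEα : ∀ R : ℝ, 0 < R → ∀ p ∈ IMCF.extrinsicBall X R,
      E R p = α * IMCF.transplantedExitTime n X R p) :
    IMCF.IsSoliton (n := n) X (α / ((α - 1) * n)) ∧
      (1 < α → IMCF.IsSelfExpander (n := n) X) ∧
      (0 < α → α < 1 → IMCF.IsSelfShrinker (n := n) X) := by
  have hn0 : (n : ℝ) ≠ 0 := by exact_mod_cast (by omega : n ≠ 0)
  have hnpos : (0 : ℝ) < n := by exact_mod_cast hn
  have hα1' : α - 1 ≠ 0 := sub_ne_zero.2 hα1
  have hinner (p : M) :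
      inner ℝ (IMCF.meanCurvature (n := n) X p) (X p) = -(α / ((α - 1) * n))⁻¹ := by
    -- Any radius exceeding `‖X p‖` would do: the Laplacian of `E_R` at `p` involves `R` only
    -- through an additive constant.
    have hR : 0 < ‖X p‖ + 1 := by positivity
    have hp : p ∈ IMCF.extrinsicBall X (‖X p‖ + 1) := by simp [IMCF.extrinsicBall]
    have hopen : IsOpen (IMCF.extrinsicBall X (‖X p‖ + 1)) :=
      isOpen_ball.preimage hproper.continuous
    have hlap := IMCF.laplacian_eq (f := E (‖X p‖ + 1)) hX (p := p)
      (a := α * (‖X p‖ + 1) ^ 2 / (2 * n)) (b := -(α / (2 * n))) (by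
        filter_upwards [hopen.mem_nhds hp] with q hq
        rw [hEα _ hR q hq, IMCF.transplantedExitTime]
        ring)
    have hpois := (hE _ hR).poisson p hp
    rw [hlap] at hpois
    field_simp at hpois ⊢
    linarith
  have hC : α / ((α - 1) * n) ≠ 0 := div_ne_zero hα0 (mul_ne_zero hα1' hn0)
  have hne (p : M) : inner ℝ (IMCF.meanCurvature (n := n) X p) (X p) ≠ 0 := by
    rw [hinner]
    exact neg_ne_zero.2 (inv_ne_zero hC)
  have hsol : IMCF.IsSoliton (n := n) X (α / ((α - 1) * n)) := by
    refine ⟨hX, IMCF.isCompleteInduced_of_isProperMap hX hproper, fun p h => hne p ?_, fun p => ?_⟩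
    · rw [h, inner_zero_left]
    · rw [IMCF.inv_norm_sq_smul_meanCurvature hX (hne p), hinner, inv_neg, inv_inv, neg_smul]
  refine ⟨hsol, fun h => ⟨_, ?_, hsol⟩, fun h0 h1 => ⟨_, ?_, hsol⟩⟩
  · exact div_pos (by linarith) (mul_pos (by linarith) hnpos)
  · exact div_neg_of_pos_of_neg h0 (mul_neg_of_neg_of_pos (by linarith) hnpos)
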